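/- Let $2<p<\infty$, let $\mathbb D$ be the open unit disc and $\mathbb T$ its boundary. Let $D^p_{p-1}$ be the space of all analytic functions $f$ on $\mathbb D$ with $$\|f\|_{D^p_{p-1}}:=|f(0)|+\Big(\int_{\mathbb D}(1-|z|)^{p-1}|f'(z)|^p\,dA(z)\Big)^{1/p}<\infty ,$$ where $A$ is area measure, and let $\mathcal B$ be the Bloch space of all analytic functions $f$ on $\mathbb D$ with $\sup_{z\in\mathbb D}|f'(z)|(1-|z|)<\infty$. An analytic function $f$ on $\mathbb D$ is called outer if it has no zeros in $\mathbb D$, it has a radial limit $f^*$ at almost every point of $\mathbb T$, $\log|f^*|$ is integrable on $\mathbb T$, and $$\log|f(z)|=\frac1{2\pi}\int_0^{2\pi}\frac{1-|z|^2}{|e^{i\theta}-z|^2}\,\log|f^*(e^{i\theta})|\,d\theta\qquad(z\in\mathbb D).$$ A function $f\in D^p_{p-1}$ is called cyclic in $D^p_{p-1}$ if there is a sequence of polynomials $(p_n)_{n\in\mathbb N}$ such that $\|p_nf-1\|_{D^p_{p-1}}\to0$. Theorem. If $f$ is an outer function and $f\in D^p_{p-1}\cap\mathcal B$, then $f$ is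 cyclic in $D^p_{p-1}$. -/

import Mathlib

open MeasureTheory Filter Metric Topology

/-- The norm `|f(0)| + (∫_𝔻 (1 - |z|)^(p-1) |f'(z)|^p dA(z))^(1/p)` of the Besov space `D^p_{p-1}`,
as an element of `[0, ∞]`, so that it is `∞` exactly when the integral diverges. It depends only on
the values of `f` in the open unit disc `𝔻 = ball 0 1`. -/
noncomputable def besovNorm (p : ℝ) (f : ℂ → ℂ) : ENNReal :=
  ENNReal.ofReal ‖f 0‖ +
    (∫⁻ z in ball (0 : ℂ) 1, ENNReal.ofReal ((1 - ‖z‖) ^ (p - 1) * ‖deriv f z‖ ^ p)) ^ (1 / p)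

/-- Membership in the Besov space `D^p_{p-1}`: analytic in the open unit disc, of finite norm. -/
def MemBesov (p : ℝ) (f : ℂ → ℂ) : Prop :=
  DifferentiableOn ℂ f (ball 0 1) ∧ besovNorm p f < ⊤

/-- Membership in the Bloch space: analytic in the open unit disc, with
`sup_{z ∈ 𝔻} |f'(z)| (1 - |z|) < ∞`. -/
def MemBloch (f : ℂ → ℂ) : Prop :=
  DifferentiableOn ℂ f (ball 0 1) ∧
    BddAbove ((fun z : ℂ => ‖deriv f z‖ * (1 - ‖z‖)) '' ball 0 1)

/-- Outer functions: analytic and without zeros in the open unit disc, with a radial limit `f*` at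
almost every point of the unit circle such that `log |f*|` is integrable on the circle and
`log |f|` is its Poisson integral (at `z = 0` this reads: `log |f(0)|` is the mean value of
`log |f*|` over the circle). The last condition implies that `f*` is nonzero almost everywhere. -/
def IsOuter (f : ℂ → ℂ) : Prop :=
  DifferentiableOn ℂ f (ball 0 1) ∧
  (∀ z ∈ ball (0 : ℂ) 1, f z ≠ 0) ∧
  ∃ fstar : ℂ → ℂ,
    (∀ᵐ θ : ℝ, Tendsto (fun r : ℝ => f (circleMap 0 r θ)) (𝓝[<] 1)
      (𝓝 (fstar (circleMap 0 1 θ)))) ∧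
    CircleIntegrable (fun ζ => Real.log ‖fstar ζ‖) 0 1 ∧
    ∀ z ∈ ball (0 : ℂ) 1,
      Real.log ‖f z‖ =
        Real.circleAverage (fun ζ => poissonKernel 0 z ζ * Real.log ‖fstar ζ‖) 0 1

/-- `f` is cyclic in `D^p_{p-1}`: it belongs to the space and there are polynomials `P n` with
`‖P n * f - 1‖ → 0` in the norm of the space. -/
def IsCyclicBesov (p : ℝ) (f : ℂ → ℂ) : Prop :=
  MemBesov p f ∧
    ∃ P : ℕ → Polynomial ℂ,
      Tendsto (fun n => besovNorm p (fun z => (P n).eval z * f z - 1)) atTop (𝓝 0)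

/-! Write `L = log |f*|`. The Poisson integral of `min (n, -L)` is `log |g|` for a zero-free
analytic `g`. Then `|g| ≤ e^n`, and `log |g f|` is the Poisson integral of `min (n + L, 0)`, because
`log |f|` is the Poisson integral of `L`. Hence `|g f| ≤ 1`. As `n → ∞`, the mean of `min (n + L,
0)` tends to `0`, so after a rotation `g(0) f(0)` is close to `1`.

A function `h` with `|h| ≤ 1` has small energy when `|h(0)|` is near `1`. The Cauchy estimate `|h'|
(1 - |z|) ≤ 1` reduces exponent `p` to exponent `2`, and there Parseval bounds the energy by `π/2 (1
- |h(0)|²)`. So `g f` is close to `1` in the space.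

It remains to replace `g` by a polynomial. The dilation `g_r(z) = g(rz)` is analytic across the
closed disc, so it can be approximated by polynomials together with its derivative. The heart of the
matter is that `g_r f → g f` in energy as `r → 1`. The dangerous term is `g'(rz) f(z)`, since `f`
may be unbounded. Write `f(z) = f(rz) + (f(z) - f(rz))`: the first part is controlled by `(g
f)'(rz)` and `g(rz) f'(rz)`. For the second, the Bloch condition gives `|f(z) - f(rz)| ≤ M log ((1 -
r|z|)/(1 - |z|))`, and a power dominates the logarithm, so the weight at `z` is traded for the
weight at `rz`. Everything is then bounded by an integrable function and its dilation, and a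
dominated convergence theorem with varying bounds applies.

Dilation and the polynomial approximation both preserve the value at the origin, so only energies
have to be estimated in these two steps. -/

/-! ### Poisson integrals and bounded multipliers of outer functions. -/

/-- The Poisson integral of a function on the unit circle. -/
noncomputable def poissonIntegral (u : ℂ → ℝ) (z : ℂ) : ℝ :=
  Real.circleAverage (fun ζ => poissonKernel 0 z ζ * u ζ) 0 1

theorem continuousOn_poissonKernel {z : ℂ} (hz : z ∈ ball (0 : ℂ) 1) :
    ContinuousOn (poissonKernel 0 z) (sphere 0 |1|) := by
  rw [poissonKernel_eq_re_herglotzRieszKernel]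
  exact Complex.continuous_re.comp_continuousOn (continuousOn_herglotzRieszKernel_sphere hz)

theorem CircleIntegrable.poissonKernel_mul {u : ℂ → ℝ} (hu : CircleIntegrable u 0 1) {z : ℂ}
    (hz : z ∈ ball (0 : ℂ) 1) :
    CircleIntegrable (fun ζ => poissonKernel 0 z ζ * u ζ) 0 1 :=
  hu.continuousOn_smul (continuousOn_poissonKernel hz)

theorem poissonIntegral_add {u v : ℂ → ℝ} (hu : CircleIntegrable u 0 1)
    (hv : CircleIntegrable v 0 1) {z : ℂ} (hz : z ∈ ball (0 : ℂ) 1) :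
    poissonIntegral (fun ζ => u ζ + v ζ) z = poissonIntegral u z + poissonIntegral v z := by
  unfold poissonIntegral
  rw [← Real.circleAverage_fun_add (hu.poissonKernel_mul hz) (hv.poissonKernel_mul hz)]
  simp only [mul_add]

theorem poissonIntegral_one {z : ℂ} (hz : z ∈ ball (0 : ℂ) 1) :
    poissonIntegral (fun _ => 1) z = 1 := by
  have h := (diffContOnCl_const (c := (1 : ℂ)) : DiffContOnCl ℂ _ (ball (0 : ℂ) 1)
    ).circleAverage_poissonKernel_smul hz
  have h1 : CircleIntegrable (fun ζ => poissonKernel 0 z ζ * (1 : ℝ)) 0 1 :=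
    CircleIntegrable.poissonKernel_mul (circleIntegrable_const 1 0 1) hz
  have h2 := Complex.ofRealCLM.circleAverage_comp_comm h1
  have h3 : (poissonKernel 0 z • fun _ : ℂ => (1 : ℂ)) =
      Complex.ofRealCLM ∘ fun ζ => poissonKernel 0 z ζ * (1 : ℝ) := by
    ext ζ; simp
  rw [h3, h2] at h
  exact Complex.ofReal_injective (by simpa [poissonIntegral] using h)

theorem poissonIntegral_mono {u v : ℂ → ℝ} (hu : CircleIntegrable u 0 1)
    (hv : CircleIntegrable v 0 1) (huv : ∀ ζ, u ζ ≤ v ζ) {z : ℂ} (hz : z ∈ ball (0 : ℂ) 1) :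
    poissonIntegral u z ≤ poissonIntegral v z := by
  refine Real.circleAverage_mono (hu.poissonKernel_mul hz) (hv.poissonKernel_mul hz) ?_
  intro ζ hζ
  refine mul_le_mul_of_nonneg_left (huv ζ) ?_
  have h1 : ‖z‖ < 1 := by simpa using hz
  have h2 : ‖ζ‖ = 1 := by simpa using hζ
  rw [poissonKernel_def]
  simp only [sub_zero, h2]
  exact div_nonneg (by nlinarith [norm_nonneg z]) (by positivity)

theorem poissonIntegral_le_of_le {u : ℂ → ℝ} (hu : CircleIntegrable u 0 1) {a : ℝ}
    (hua : ∀ ζ, u ζ ≤ a) {z : ℂ} (hz : z ∈ ball (0 : ℂ) 1) : poissonIntegral u z ≤ a := by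
  refine (poissonIntegral_mono hu (circleIntegrable_const a 0 1) hua hz).trans_eq ?_
  have h := poissonIntegral_one hz
  unfold poissonIntegral at h ⊢
  simp only [mul_one] at h
  simp_rw [mul_comm _ a, ← smul_eq_mul (a := a)]
  rw [Real.circleAverage_fun_smul, h, smul_eq_mul, mul_one]

theorem poissonIntegral_zero (u : ℂ → ℝ) : poissonIntegral u 0 = Real.circleAverage u 0 1 := by
  refine Real.circleAverage_congr_sphere fun ζ hζ => ?_
  have h2 : ‖ζ‖ = 1 := by simpa using hζ
  simp [poissonKernel_def, h2]

/-- A circle integrable function is the boundary logarithm of the modulus of a zero-free analytic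
function on the disc. -/
theorem exists_norm_eq_exp_poissonIntegral {u : ℂ → ℝ} (hu : CircleIntegrable u 0 1) :
    ∃ g : ℂ → ℂ, DifferentiableOn ℂ g (ball 0 1) ∧
      ∀ z ∈ ball (0 : ℂ) 1, ‖g z‖ = Real.exp (poissonIntegral u z) := by
  have hu' : CircleIntegrable (fun ζ => (u ζ : ℂ)) 0 1 := by
    simp only [CircleIntegrable, intervalIntegrable_iff] at hu ⊢
    exact Complex.ofRealCLM.integrable_comp hu
  refine ⟨fun z => Complex.exp (Real.circleAverage
    (fun ζ => herglotzRieszKernel 0 z ζ • (u ζ : ℂ)) 0 1),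
    (differentiableOn_circleAverage_herglotzRieszKernel_smul hu').cexp, fun z hz => ?_⟩
  rw [Complex.norm_exp, re_circleAverage_herglotzRieszKernel_smul hu hz,
    ← poissonKernel_eq_re_herglotzRieszKernel]
  rfl

theorem CircleIntegrable.min_fun {u v : ℂ → ℝ} {c : ℂ} {R : ℝ} (hu : CircleIntegrable u c R)
    (hv : CircleIntegrable v c R) : CircleIntegrable (fun ζ => min (u ζ) (v ζ)) c R := by
  simp only [CircleIntegrable, intervalIntegrable_iff] at hu hv ⊢
  exact hu.inf hv

/-- The integrands are dominated by `|L|` and vanish at each point once `n ≥ -L`. This limit drives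
`|g(0) f(0)|` to `1` for the truncated multiplier `g`. -/
theorem tendsto_circleAverage_min_natCast_add {L : ℂ → ℝ} (hL : CircleIntegrable L 0 1) :
    Tendsto (fun n : ℕ => Real.circleAverage (fun ζ => min (n + L ζ) 0) 0 1) atTop (𝓝 0) := by
  have key : Tendsto (fun n : ℕ => ∫ θ in (0 : ℝ)..2 * Real.pi,
      min (n + L (circleMap 0 1 θ)) 0) atTop (𝓝 (∫ _θ in (0 : ℝ)..2 * Real.pi, (0 : ℝ))) := by
    refine intervalIntegral.tendsto_integral_filter_of_dominated_convergence
      (fun θ => |L (circleMap 0 1 θ)|) ?_ ?_ ?_ ?_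
    · refine Eventually.of_forall fun n => ?_
      have := ((circleIntegrable_const (n : ℝ) 0 1).add hL).min_fun (circleIntegrable_const 0 0 1)
      exact ((intervalIntegrable_iff.1 this).aestronglyMeasurable)
    · refine Eventually.of_forall fun n => ae_of_all _ fun θ _ => ?_
      have hn : (0 : ℝ) ≤ n := n.cast_nonneg
      rw [Real.norm_eq_abs, abs_of_nonpos (min_le_right _ _), neg_le, le_min_iff]
      exact ⟨by linarith [neg_abs_le (L (circleMap 0 1 θ))], by simp⟩
    · exact IntervalIntegrable.abs hL
    · refine ae_of_all _ fun θ _ => tendsto_const_nhds.congr' ?_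
      obtain ⟨N, hN⟩ := exists_nat_ge (-L (circleMap 0 1 θ))
      filter_upwards [eventually_ge_atTop N] with n hn
      have : (N : ℝ) ≤ n := by exact_mod_cast hn
      rw [min_eq_right]; linarith
  simpa [Real.circleAverage] using key.const_mul (2 * Real.pi)⁻¹

/-- An outer function has bounded analytic multipliers `g` with `‖g * f‖ ≤ 1` on the disc and
`g 0 * f 0` as close to `1` as one wishes. -/
theorem IsOuter.exists_bounded_multiplier {f : ℂ → ℂ} (hf : IsOuter f) {ε : ℝ} (hε : 0 < ε) :
    ∃ (g : ℂ → ℂ) (N : ℝ), DifferentiableOn ℂ g (ball 0 1) ∧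
      (∀ z ∈ ball (0 : ℂ) 1, ‖g z‖ ≤ N) ∧ (∀ z ∈ ball (0 : ℂ) 1, ‖g z * f z‖ ≤ 1) ∧
      ‖g 0 * f 0 - 1‖ < ε := by
  obtain ⟨-, hf0, fstar, -, hL, hfL⟩ := hf
  set L : ℂ → ℝ := fun ζ => Real.log ‖fstar ζ‖ with hLdef
  replace hfL : ∀ z ∈ ball (0 : ℂ) 1, ‖f z‖ = Real.exp (poissonIntegral L z) := fun z hz => by
    rw [poissonIntegral, ← hfL z hz, Real.exp_log (norm_pos_iff.2 (hf0 z hz))]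
  have h0 : (0 : ℂ) ∈ ball (0 : ℂ) 1 := by simp
  have ht : Tendsto (fun n : ℕ =>
      1 - Real.exp (Real.circleAverage (fun ζ => min (n + L ζ) 0) 0 1)) atTop (𝓝 0) := by
    simpa using ((tendsto_circleAverage_min_natCast_add hL).rexp).const_sub 1
  obtain ⟨n, hn⟩ := (ht.eventually (gt_mem_nhds hε)).exists
  -- The boundary logarithm of `|1/f|`, truncated at height `n` to keep the multiplier bounded.
  have hu : CircleIntegrable (fun ζ => min (n : ℝ) (-L ζ)) 0 1 :=
    (circleIntegrable_const (n : ℝ) 0 1).min_fun hL.neg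
  have hsum : CircleIntegrable (fun ζ => min (n + L ζ) 0) 0 1 :=
    ((circleIntegrable_const (n : ℝ) 0 1).add hL).min_fun (circleIntegrable_const 0 0 1)
  obtain ⟨g, hg, hgu⟩ := exists_norm_eq_exp_poissonIntegral hu
  have hgf : ∀ z ∈ ball (0 : ℂ) 1,
      ‖g z * f z‖ = Real.exp (poissonIntegral (fun ζ => min (n + L ζ) 0) z) := fun z hz => by
    rw [norm_mul, hgu z hz, hfL z hz, ← Real.exp_add, ← poissonIntegral_add hu hL hz]
    congr 2
    ext ζ
    rw [← min_add_add_right]; simp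
  have hne : g 0 * f 0 ≠ 0 := by rw [← norm_pos_iff, hgf 0 h0]; positivity
  -- A unimodular constant that makes the value at the origin positive, so that closeness of its
  -- modulus to `1` suffices.
  set κ : ℂ := ‖g 0 * f 0‖ / (g 0 * f 0) with hκ
  have hκ1 : ‖κ‖ = 1 := by
    rw [hκ, norm_div, Complex.norm_real, norm_norm, div_self (norm_ne_zero_iff.2 hne)]
  refine ⟨fun z => κ * g z, Real.exp n, hg.const_mul κ, fun z hz => ?_, fun z hz => ?_, ?_⟩
  · rw [norm_mul, hκ1, one_mul, hgu z hz, Real.exp_le_exp]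
    exact poissonIntegral_le_of_le hu (fun ζ => min_le_left _ _) hz
  · rw [mul_assoc, norm_mul, hκ1, one_mul, hgf z hz, Real.exp_le_one_iff]
    exact poissonIntegral_le_of_le hsum (fun ζ => min_le_right _ _) hz
  · have h1 : κ * g 0 * f 0 = ‖g 0 * f 0‖ := by rw [mul_assoc, hκ, div_mul_cancel₀ _ hne]
    have h2 := hgf 0 h0
    rw [poissonIntegral_zero] at h2
    have h3 : ‖g 0 * f 0‖ ≤ 1 := by
      rw [hgf 0 h0, Real.exp_le_one_iff]
      exact poissonIntegral_le_of_le hsum (fun ζ => min_le_right _ _) h0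
    rw [h1, ← Complex.ofReal_one, ← Complex.ofReal_sub, Complex.norm_real, Real.norm_eq_abs,
      abs_sub_comm, abs_of_nonneg (by linarith), h2]
    exact hn

/-! ### Taylor coefficients and the Littlewood–Paley inequality. -/

/-- Parseval's identity on the unit circle for absolutely convergent power series. -/
theorem hasSum_sq_norm_circleAverage {c : ℕ → ℂ} {F : ℂ → ℂ} (hc : Summable fun n => ‖c n‖)
    (hF : ∀ ζ ∈ sphere (0 : ℂ) 1, HasSum (fun n => c n * ζ ^ n) (F ζ)) :
    HasSum (fun n => ‖c n‖ ^ 2) (Real.circleAverage (fun ζ => ‖F ζ‖ ^ 2) 0 1) := by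
  rw [hasSum_iff_tendsto_nat_of_nonneg fun n => by positivity]
  set P : ℕ → Polynomial ℂ := fun n => ∑ i ∈ Finset.range n, Polynomial.monomial i (c i) with hP
  have hcoeff : ∀ n i, (P n).coeff i = if i < n then c i else 0 := fun n i => by
    simp [hP, Polynomial.finsetSum_coeff, Polynomial.coeff_monomial]
  have heval : ∀ n ζ, (P n).eval ζ = ∑ i ∈ Finset.range n, c i * ζ ^ i := fun n ζ => by
    simp [hP, Polynomial.eval_finsetSum]
  have hsum : ∀ n, ∑ i ∈ Finset.range n, ‖c i‖ ^ 2 =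
      Real.circleAverage (fun ζ => ‖(P n).eval ζ‖ ^ 2) 0 1 := fun n => by
    rw [← Polynomial.sum_sq_norm_coeff_eq_circleAverage]
    symm
    refine Finset.sum_subset_zero_on_sdiff (fun i hi => ?_) (fun i hi => ?_) (fun i hi => ?_)
    · by_contra h
      simp only [Finset.mem_range] at h
      simp [hcoeff, h] at hi
    · have := (Finset.mem_sdiff.1 hi)
      rw [Finset.mem_range, Polynomial.notMem_support_iff, hcoeff] at this
      rw [if_pos this.1] at this
      simp [this.2]
    · have : i < n := by
        by_contra h
        simp [hcoeff, h] at hi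
      rw [hcoeff, if_pos this]
  simp_rw [hsum]
  refine Tendsto.const_smul ?_ _
  refine intervalIntegral.tendsto_integral_filter_of_dominated_convergence
    (fun _ => (∑' n, ‖c n‖) ^ 2) ?_ ?_ (by simp) ?_
  · refine Eventually.of_forall fun n => Continuous.aestronglyMeasurable ?_
    have := (P n).continuous
    fun_prop
  · refine Eventually.of_forall fun n => ae_of_all _ fun θ _ => ?_
    rw [norm_pow, norm_norm]
    gcongr
    rw [heval]
    refine (norm_sum_le _ _).trans ((Finset.sum_le_sum fun i _ => ?_).trans
      (hc.sum_le_tsum (Finset.range n) fun i _ => norm_nonneg _))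
    simp
  · refine ae_of_all _ fun θ _ => ?_
    have h := (hF (circleMap 0 1 θ) (by simp)).tendsto_sum_nat
    simp_rw [heval]
    exact (h.norm).pow 2

/-- The Taylor coefficients at the origin. -/
noncomputable def taylorCoeff (h : ℂ → ℂ) (n : ℕ) : ℂ := iteratedDeriv n h 0 / n.factorial

theorem hasSum_taylorCoeff {h : ℂ → ℂ} (hh : DifferentiableOn ℂ h (ball 0 1)) {z : ℂ}
    (hz : z ∈ ball (0 : ℂ) 1) : HasSum (fun n => taylorCoeff h n * z ^ n) (h z) := by
  have e : (fun n => taylorCoeff h n * z ^ n) =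
      fun n => (n.factorial : ℂ)⁻¹ • (z - 0) ^ n • iteratedDeriv n h 0 := by
    ext n
    rw [sub_zero, taylorCoeff, smul_eq_mul, smul_eq_mul]
    ring
  rw [e]
  exact Complex.hasSum_taylorSeries_on_ball hh hz

theorem taylorCoeff_deriv (h : ℂ → ℂ) (n : ℕ) :
    taylorCoeff (deriv h) n = (n + 1) * taylorCoeff h (n + 1) := by
  rw [taylorCoeff, taylorCoeff, iteratedDeriv_succ', Nat.factorial_succ]
  have : (n.factorial : ℂ) ≠ 0 := by exact_mod_cast n.factorial_ne_zero
  have : (n + 1 : ℂ) ≠ 0 := by exact_mod_cast n.succ_ne_zero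
  push_cast
  field_simp

/-- Parseval for the dilated function `h (r ·)`, whose Taylor series converges absolutely on the
unit circle because `r < 1`. -/
theorem hasSum_sq_norm_taylorCoeff {h : ℂ → ℂ} (hh : DifferentiableOn ℂ h (ball 0 1)) {r : ℝ}
    (hr0 : 0 ≤ r) (hr : r < 1) :
    HasSum (fun n => ‖taylorCoeff h n‖ ^ 2 * r ^ (2 * n))
      (Real.circleAverage (fun ζ => ‖h ζ‖ ^ 2) 0 r) := by
  have hball : ∀ ζ : ℂ, ‖ζ‖ = 1 → (r : ℂ) * ζ ∈ ball (0 : ℂ) 1 := fun ζ hζ => by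
    simpa [hζ, abs_of_nonneg hr0] using hr
  have h1 : ∀ ζ : ℂ, ‖ζ‖ = 1 → HasSum (fun n => taylorCoeff h n * r ^ n * ζ ^ n) (h (r * ζ)) :=
    fun ζ hζ => by
      have := hasSum_taylorCoeff hh (hball ζ hζ)
      simpa only [mul_pow, mul_assoc] using this
  have h2 : Summable fun n => ‖taylorCoeff h n * (r : ℂ) ^ n‖ := by
    have := (h1 1 (by simp)).summable.norm
    simpa using this
  have h3 := hasSum_sq_norm_circleAverage (F := fun ζ => h (r * ζ)) h2
    (fun ζ hζ => h1 ζ (by simpa using hζ))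
  rw [Real.circleAverage_eq_circleAverage_zero_one]
  convert! h3 using 2
  · rw [norm_mul, norm_pow, Complex.norm_real, Real.norm_eq_abs, abs_of_nonneg hr0]
    ring
  · simp

theorem sum_sq_norm_taylorCoeff_le_one {h : ℂ → ℂ} (hh : DifferentiableOn ℂ h (ball 0 1))
    (hb : ∀ z ∈ ball (0 : ℂ) 1, ‖h z‖ ≤ 1) (N : ℕ) :
    ∑ n ∈ Finset.range N, ‖taylorCoeff h n‖ ^ 2 ≤ 1 := by
  have ht : Tendsto (fun r : ℝ => ∑ n ∈ Finset.range N, ‖taylorCoeff h n‖ ^ 2 * r ^ (2 * n))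
      (𝓝[<] 1) (𝓝 (∑ n ∈ Finset.range N, ‖taylorCoeff h n‖ ^ 2 * 1 ^ (2 * n))) := by
    refine tendsto_nhdsWithin_of_tendsto_nhds (Continuous.tendsto ?_ 1)
    fun_prop
  simp only [one_pow, mul_one] at ht
  refine le_of_tendsto ht ?_
  filter_upwards [Ioo_mem_nhdsLT (zero_lt_one (α := ℝ))] with r hr
  refine (sum_le_hasSum _ (fun n _ => ?_) (hasSum_sq_norm_taylorCoeff hh hr.1.le hr.2)).trans ?_
  · have := hr.1.le
    positivity
  · have hs : ∀ ζ ∈ sphere (0 : ℂ) |r|, ζ ∈ ball (0 : ℂ) 1 := fun ζ hζ => by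
      have : ‖ζ‖ = |r| := by simpa using hζ
      simpa [this, abs_of_pos hr.1] using hr.2
    refine Real.circleAverage_mono_on_of_le_circle ?_ fun ζ hζ => ?_
    · refine ContinuousOn.circleIntegrable' ?_
      exact ((hh.continuousOn.mono hs).norm).pow 2
    · have := hb ζ (hs ζ hζ)
      nlinarith [norm_nonneg (h ζ)]

theorem lintegral_ball_eq_polar {F : ℂ → ENNReal} (hF : Measurable F) :
    ∫⁻ z in ball (0 : ℂ) 1, F z = ∫⁻ r in Set.Ioo (0 : ℝ) 1,
      ENNReal.ofReal r * ∫⁻ θ in Set.Ioo (-Real.pi) Real.pi, F (circleMap 0 r θ) := by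
  have hpolar : ∀ q : ℝ × ℝ, Complex.polarCoord.symm q = circleMap 0 q.1 q.2 := fun q => by
    rw [Complex.polarCoord_symm_apply, circleMap_zero, Complex.exp_mul_I]
    simp
  have hcm : Measurable fun q : ℝ × ℝ => circleMap 0 q.1 q.2 := by
    have : Continuous fun q : ℝ × ℝ => circleMap 0 q.1 q.2 := by
      simp only [circleMap]; fun_prop
    exact this.measurable
  rw [← lintegral_indicator measurableSet_ball, ← Complex.lintegral_comp_polarCoord_symm]
  have hG : Measurable ((ball (0 : ℂ) 1).indicator F) := hF.indicator measurableSet_ball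
  simp_rw [hpolar, polarCoord_target, smul_eq_mul]
  rw [Measure.volume_eq_prod, ← Measure.prod_restrict, lintegral_prod _ (by
    refine AEMeasurable.mul ?_ (hG.comp hcm).aemeasurable
    exact (measurable_fst.ennreal_ofReal).aemeasurable),
    ← lintegral_indicator measurableSet_Ioi, ← lintegral_indicator measurableSet_Ioo]
  congr 1
  ext r
  by_cases h0 : 0 < r
  · dsimp only
    rw [Set.indicator_of_mem (Set.mem_Ioi.2 h0), lintegral_const_mul]
    · by_cases h1 : r < 1
      · rw [Set.indicator_of_mem (show r ∈ Set.Ioo (0 : ℝ) 1 from ⟨h0, h1⟩)]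
        congr 2
        ext θ
        exact Set.indicator_of_mem (by simpa [abs_of_pos h0] using h1) _
      · rw [Set.indicator_of_notMem (show r ∉ Set.Ioo (0 : ℝ) 1 from fun h => h1 h.2)]
        have : ∀ θ, (ball (0 : ℂ) 1).indicator F (circleMap 0 r θ) = 0 := fun θ =>
          Set.indicator_of_notMem (by simpa [abs_of_pos h0] using h1) _
        simp [this]
    · exact hG.comp (hcm.comp measurable_prodMk_left)
  · rw [Set.indicator_of_notMem (show r ∉ Set.Ioi (0 : ℝ) from h0),
      Set.indicator_of_notMem (show r ∉ Set.Ioo (0 : ℝ) 1 from fun h => h0 h.1)]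

theorem lintegral_circleMap_eq_ofReal_circleAverage {u : ℂ → ℝ} {r : ℝ}
    (hu : CircleIntegrable u 0 r) (h0 : ∀ ζ, 0 ≤ u ζ) :
    ∫⁻ θ in Set.Ioo (-Real.pi) Real.pi, ENNReal.ofReal (u (circleMap 0 r θ)) =
      ENNReal.ofReal (2 * Real.pi * Real.circleAverage u 0 r) := by
  -- Polar coordinates use angles in `(-π, π)`, circle averages use `(0, 2π)`; periodicity
  -- reconciles them.
  have hper : Function.Periodic (fun θ => u (circleMap 0 r θ)) (2 * Real.pi) := fun θ => by
    simp only [periodic_circleMap 0 r θ]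
  have hi : IntervalIntegrable (fun θ => u (circleMap 0 r θ)) volume (-Real.pi) Real.pi := by
    have := hper.intervalIntegrable (t := 0) Real.two_pi_pos.ne'
      (by rw [zero_add]; exact hu) (-Real.pi) Real.pi
    exact this
  have hle : -Real.pi ≤ Real.pi := by linarith [Real.pi_pos]
  have hint : Integrable (fun θ => u (circleMap 0 r θ))
      (volume.restrict (Set.Ioo (-Real.pi) Real.pi)) :=
    ((intervalIntegrable_iff_integrableOn_Ioo_of_le hle).1 hi)
  rw [← ofReal_integral_eq_lintegral_ofReal hint (ae_of_all _ fun θ => h0 _)]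
  congr 1
  have h2 := hper.intervalIntegral_add_eq (-Real.pi) 0
  rw [← integral_Ioc_eq_integral_Ioo, ← intervalIntegral.integral_of_le hle, Real.circleAverage,
    smul_eq_mul, ← mul_assoc, mul_inv_cancel₀ Real.two_pi_pos.ne', one_mul]
  convert! h2 using 2 <;> ring

theorem lintegral_pow_mul_one_sub (n : ℕ) :
    ∫⁻ r in Set.Ioo (0 : ℝ) 1, ENNReal.ofReal (r * (1 - r) * r ^ (2 * n)) =
      ENNReal.ofReal (1 / ((2 * n + 2) * (2 * n + 3))) := by
  have hcont : Continuous fun r : ℝ => r * (1 - r) * r ^ (2 * n) := by fun_prop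
  rw [← ofReal_integral_eq_lintegral_ofReal
    ((hcont.integrableOn_Icc (a := 0) (b := 1)).mono_set Set.Ioo_subset_Icc_self)]
  · congr 1
    rw [← integral_Ioc_eq_integral_Ioo, ← intervalIntegral.integral_of_le zero_le_one]
    have : ∀ r : ℝ, r * (1 - r) * r ^ (2 * n) = r ^ (2 * n + 1) - r ^ (2 * n + 2) := fun r => by
      ring
    simp_rw [this]
    rw [intervalIntegral.integral_sub (by simp) (by simp), integral_pow, integral_pow]
    have h1 : (2 * n + 2 : ℝ) ≠ 0 := by positivity
    have h2 : (2 * n + 3 : ℝ) ≠ 0 := by positivity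
    push_cast
    rw [show (2 * n + 1 + 1 : ℝ) = 2 * n + 2 by ring, show (2 * n + 2 + 1 : ℝ) = 2 * n + 3 by ring]
    field_simp
    simp
    ring
  · filter_upwards [ae_restrict_mem measurableSet_Ioo] with r hr
    have := hr.1.le
    have : 0 ≤ 1 - r := by linarith [hr.2]
    simp only [Pi.zero_apply]
    positivity

/-- The area form of the Littlewood–Paley inequality in `H²`, for bounded functions. -/
theorem lintegral_one_sub_norm_mul_sq_deriv_le {h : ℂ → ℂ}
    (hh : DifferentiableOn ℂ h (ball 0 1)) (hb : ∀ z ∈ ball (0 : ℂ) 1, ‖h z‖ ≤ 1) :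
    ∫⁻ z in ball (0 : ℂ) 1, ENNReal.ofReal ((1 - ‖z‖) * ‖deriv h z‖ ^ 2) ≤
      ENNReal.ofReal (Real.pi / 2 * (1 - ‖h 0‖ ^ 2)) := by
  have hh' : DifferentiableOn ℂ (deriv h) (ball 0 1) := hh.deriv isOpen_ball
  have hmeas : Measurable fun z : ℂ => ENNReal.ofReal ((1 - ‖z‖) * ‖deriv h z‖ ^ 2) :=
    ((measurable_norm.const_sub 1).mul ((measurable_deriv h).norm.pow_const 2)).ennreal_ofReal
  rw [lintegral_ball_eq_polar hmeas]
  -- Parseval on each circle turns the angular integral into a series with nonnegative terms, which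
  -- can be integrated in `r` term by term.
  have hstep : ∀ r ∈ Set.Ioo (0 : ℝ) 1, ENNReal.ofReal r * ∫⁻ θ in Set.Ioo (-Real.pi) Real.pi,
      ENNReal.ofReal ((1 - ‖circleMap 0 r θ‖) * ‖deriv h (circleMap 0 r θ)‖ ^ 2) =
      ∑' n, ENNReal.ofReal (2 * Real.pi * ‖taylorCoeff (deriv h) n‖ ^ 2) *
        ENNReal.ofReal (r * (1 - r) * r ^ (2 * n)) := fun r hr => by
    have hr0 := hr.1
    have hr1 : 0 ≤ 1 - r := by linarith [hr.2]
    have hs : ∀ ζ ∈ sphere (0 : ℂ) |r|, ζ ∈ ball (0 : ℂ) 1 := fun ζ hζ => by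
      have : ‖ζ‖ = |r| := by simpa using hζ
      simpa [this, abs_of_pos hr.1] using hr.2
    have hsum := hasSum_sq_norm_taylorCoeff hh' hr.1.le hr.2
    simp_rw [norm_circleMap_zero, abs_of_pos hr0, ENNReal.ofReal_mul hr1]
    rw [lintegral_const_mul' _ _ ENNReal.ofReal_ne_top,
      lintegral_circleMap_eq_ofReal_circleAverage (u := fun ζ => ‖deriv h ζ‖ ^ 2)
        (((hh'.continuousOn.mono hs).norm.pow 2).circleIntegrable') (fun ζ => by positivity),
      ← hsum.tsum_eq, ← tsum_mul_left, ENNReal.ofReal_tsum_of_nonneg (fun n => by positivity)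
        (hsum.summable.mul_left _), ← ENNReal.tsum_mul_left, ← ENNReal.tsum_mul_left]
    congr 1
    ext n
    rw [← ENNReal.ofReal_mul hr1, ← ENNReal.ofReal_mul hr0.le,
      ← ENNReal.ofReal_mul (by positivity)]
    congr 1
    ring
  rw [setLIntegral_congr_fun measurableSet_Ioo hstep, lintegral_tsum fun n => by fun_prop]
  simp_rw [lintegral_const_mul' _ _ ENNReal.ofReal_ne_top, lintegral_pow_mul_one_sub]
  refine ENNReal.tsum_le_of_sum_range_le fun N => ?_
  -- The factor is `2π (n+1)² / ((2n+2)(2n+3)) = π (n+1)/(2n+3) ≤ π/2`.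
  have hterm : ∀ n : ℕ, ENNReal.ofReal (2 * Real.pi * ‖taylorCoeff (deriv h) n‖ ^ 2) *
      ENNReal.ofReal (1 / ((2 * n + 2) * (2 * n + 3))) ≤
      ENNReal.ofReal (Real.pi / 2 * ‖taylorCoeff h (n + 1)‖ ^ 2) := fun n => by
    rw [← ENNReal.ofReal_mul (by positivity)]
    refine ENNReal.ofReal_le_ofReal ?_
    rw [taylorCoeff_deriv, norm_mul, show (n + 1 : ℂ) = ((n + 1 : ℕ) : ℂ) by push_cast; rfl,
      Complex.norm_natCast, mul_one_div, div_le_iff₀ (by positivity)]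
    push_cast
    have : 0 ≤ Real.pi * ‖taylorCoeff h (n + 1)‖ ^ 2 * (n + 1) := by positivity
    nlinarith
  refine (Finset.sum_le_sum fun n _ => hterm n).trans ?_
  rw [← ENNReal.ofReal_sum_of_nonneg fun n _ => by positivity, ← Finset.mul_sum]
  refine ENNReal.ofReal_le_ofReal (mul_le_mul_of_nonneg_left ?_ (by positivity))
  -- Only coefficients of positive index occur on the left; splitting off index `0` yields `1 - ‖h
  -- 0‖ ^ 2`.
  have := sum_sq_norm_taylorCoeff_le_one hh hb (N + 1)
  rw [Finset.sum_range_succ'] at this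
  have h0 : taylorCoeff h 0 = h 0 := by simp [taylorCoeff]
  rw [h0] at this
  linarith

/-! ### Energy of bounded functions. -/

/-- The integral part of `besovNorm`, without the root. -/
noncomputable def besovEnergy (p : ℝ) (f : ℂ → ℂ) : ENNReal :=
  ∫⁻ z in ball (0 : ℂ) 1, ENNReal.ofReal ((1 - ‖z‖) ^ (p - 1) * ‖deriv f z‖ ^ p)

/-- Cauchy's estimate on the circles of radius `ρ < 1 - ‖z‖` about `z`, followed by `ρ → 1 - ‖z‖`.
-/
theorem norm_deriv_mul_one_sub_norm_le {h : ℂ → ℂ} (hh : DifferentiableOn ℂ h (ball 0 1)) {N : ℝ}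
    (hb : ∀ z ∈ ball (0 : ℂ) 1, ‖h z‖ ≤ N) {z : ℂ} (hz : z ∈ ball (0 : ℂ) 1) :
    ‖deriv h z‖ * (1 - ‖z‖) ≤ N := by
  have hz1 : ‖z‖ < 1 := by simpa using hz
  have key : ∀ ρ ∈ Set.Ioo (0 : ℝ) (1 - ‖z‖), ‖deriv h z‖ * ρ ≤ N := fun ρ hρ => by
    have hsub : closedBall z ρ ⊆ ball (0 : ℂ) 1 := fun w hw => by
      have : ‖w - z‖ ≤ ρ := by simpa [dist_eq_norm] using hw
      have h2 : ‖w‖ ≤ ‖w - z‖ + ‖z‖ := by simpa using norm_add_le (w - z) z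
      simp only [mem_ball, dist_zero_right]
      linarith [hρ.2]
    have := Complex.norm_deriv_le_of_forall_mem_sphere_norm_le hρ.1
      ((hh.mono hsub).diffContOnCl_ball subset_rfl)
      (fun w hw => hb w (hsub (sphere_subset_closedBall hw)))
    rwa [le_div_iff₀ hρ.1] at this
  have ht : Tendsto (fun ρ : ℝ => ‖deriv h z‖ * ρ) (𝓝[<] (1 - ‖z‖))
      (𝓝 (‖deriv h z‖ * (1 - ‖z‖))) :=
    tendsto_nhdsWithin_of_tendsto_nhds (Continuous.tendsto (by fun_prop) _)
  refine le_of_tendsto ht ?_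
  filter_upwards [Ioo_mem_nhdsLT (by linarith : (0 : ℝ) < 1 - ‖z‖)] with ρ hρ using key ρ hρ

/-- The integrand is the one for exponent `2` times `(‖deriv h z‖ * (1 - ‖z‖)) ^ (p - 2)`, and this
factor is at most `1` by Cauchy's estimate. -/
theorem besovEnergy_le_of_norm_le_one {p : ℝ} (hp : 2 ≤ p) {h : ℂ → ℂ}
    (hh : DifferentiableOn ℂ h (ball 0 1)) (hb : ∀ z ∈ ball (0 : ℂ) 1, ‖h z‖ ≤ 1) :
    besovEnergy p h ≤ ENNReal.ofReal (Real.pi / 2 * (1 - ‖h 0‖ ^ 2)) := by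
  refine le_trans (setLIntegral_mono' measurableSet_ball fun z hz => ?_)
    (lintegral_one_sub_norm_mul_sq_deriv_le hh hb)
  refine ENNReal.ofReal_le_ofReal ?_
  have hz1 : 0 < 1 - ‖z‖ := by simpa using hz
  have hd := norm_deriv_mul_one_sub_norm_le hh hb hz
  have e1 : (1 - ‖z‖) ^ (p - 1) = (1 - ‖z‖) ^ (p - 2) * (1 - ‖z‖) := by
    rw [← Real.rpow_add_one hz1.ne']; ring_nf
  have e2 : ‖deriv h z‖ ^ p = ‖deriv h z‖ ^ (p - 2) * ‖deriv h z‖ ^ 2 := by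
    rw [← Real.rpow_natCast ‖deriv h z‖ 2, ← Real.rpow_add_of_nonneg (norm_nonneg _)
      (by linarith) (by norm_num)]
    norm_num
  have e3 : (‖deriv h z‖ * (1 - ‖z‖)) ^ (p - 2) ≤ 1 :=
    Real.rpow_le_one (by positivity) hd (by linarith)
  rw [Real.mul_rpow (norm_nonneg _) hz1.le] at e3
  calc _ = (‖deriv h z‖ ^ (p - 2) * (1 - ‖z‖) ^ (p - 2)) * ((1 - ‖z‖) * ‖deriv h z‖ ^ 2) := by
        rw [e1, e2]; ring
    _ ≤ 1 * ((1 - ‖z‖) * ‖deriv h z‖ ^ 2) := by gcongr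
    _ = _ := one_mul _

/-! ### Dominated convergence along dilations. -/

/-- Dominated convergence to `0` with varying bounds whose integrals converge. -/
theorem tendsto_lintegral_zero_of_le_of_tendsto {α : Type*} [MeasurableSpace α] {μ : Measure α}
    {D B : ℕ → α → ENNReal} {b : α → ENNReal} {c : ℕ → ENNReal}
    (hD : ∀ n, Measurable (D n)) (hB : ∀ n, Measurable (B n)) (hb : Measurable b)
    (hDB : ∀ n, D n ≤ᵐ[μ] B n) (hbfin : ∫⁻ a, b a ∂μ ≠ ⊤)
    (hBb : ∀ᵐ a ∂μ, Tendsto (fun n => B n a) atTop (𝓝 (b a)))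
    (hBc : ∀ n, ∫⁻ a, B n a ∂μ ≤ c n) (hc : Tendsto c atTop (𝓝 (∫⁻ a, b a ∂μ)))
    (hD0 : ∀ᵐ a ∂μ, Tendsto (fun n => D n a) atTop (𝓝 0)) :
    Tendsto (fun n => ∫⁻ a, D n a ∂μ) atTop (𝓝 0) := by
  have h1 : Tendsto (fun n => ∫⁻ a, min (D n a) (b a) ∂μ) atTop (𝓝 0) := by
    have := tendsto_lintegral_of_dominated_convergence (μ := μ) (f := fun _ => 0) b
      (fun n => (hD n).min hb) (fun n => ae_of_all _ fun a => min_le_right _ _) hbfin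
      (hD0.mono fun a ha => by simpa using ha.min tendsto_const_nhds)
    simpa using this
  have h2 : Tendsto (fun n => ∫⁻ a, min (B n a) (b a) ∂μ) atTop (𝓝 (∫⁻ a, b a ∂μ)) :=
    tendsto_lintegral_of_dominated_convergence b
      (fun n => (hB n).min hb) (fun n => ae_of_all _ fun a => min_le_right _ _) hbfin
      (hBb.mono fun a ha => by
        simpa using ha.min (tendsto_const_nhds (x := b a)))
  have h3 : Tendsto (fun n => c n - ∫⁻ a, min (B n a) (b a) ∂μ) atTop (𝓝 0) := by
    have := ENNReal.Tendsto.sub hc h2 (Or.inl hbfin)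
    rwa [tsub_self] at this
  have h4 := h1.add h3
  rw [add_zero] at h4
  refine tendsto_of_tendsto_of_tendsto_of_le_of_le tendsto_const_nhds h4 (fun n => zero_le) ?_
  intro n
  have hfin : ∫⁻ a, min (B n a) (b a) ∂μ ≠ ⊤ :=
    ne_top_of_le_ne_top hbfin (lintegral_mono fun a => min_le_right _ _)
  -- Where `D ≤ b` the first term is all of `D`; elsewhere both minima equal `b`, and the excess of
  -- `D` over `b` is at most that of `B`.
  calc ∫⁻ a, D n a ∂μ ≤ ∫⁻ a, min (D n a) (b a) + (B n a - min (B n a) (b a)) ∂μ := by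
        refine lintegral_mono_ae ((hDB n).mono fun a ha => ?_)
        rcases le_total (D n a) (b a) with h | h
        · rw [min_eq_left h]; exact le_self_add
        · rw [min_eq_right h, min_eq_right (h.trans ha)]
          exact ha.trans le_add_tsub
    _ = ∫⁻ a, min (D n a) (b a) ∂μ + (∫⁻ a, B n a ∂μ - ∫⁻ a, min (B n a) (b a) ∂μ) := by
        rw [lintegral_add_left ((hD n).min hb), lintegral_sub ((hB n).min hb) hfin
          (ae_of_all _ fun a => min_le_left _ _)]
    _ ≤ _ := by
        dsimp only
        gcongr
        exact hBc n

theorem mul_mem_unitBall {r : ℝ} (hr0 : 0 ≤ r) (hr : r ≤ 1) {z : ℂ} (hz : z ∈ ball (0 : ℂ) 1) :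
    (r : ℂ) * z ∈ ball (0 : ℂ) 1 := by
  have : ‖z‖ < 1 := by simpa using hz
  simp only [mem_ball, dist_zero_right, norm_mul, Complex.norm_real, Real.norm_eq_abs,
    abs_of_nonneg hr0]
  exact (mul_le_of_le_one_left (norm_nonneg z) hr).trans_lt this

/-- Scaling by `r` multiplies area by `r ^ 2` and maps the disc into itself. The constant tends to
`1` as `r → 1`, as convergence of the dominating integrals requires. -/
theorem lintegral_ball_comp_mul_le {T : ℂ → ENNReal} (hT : Measurable T) {r : ℝ} (hr0 : 0 < r)
    (hr : r ≤ 1) :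
    ∫⁻ z in ball (0 : ℂ) 1, T (r * z) ≤
      ENNReal.ofReal (r ^ 2)⁻¹ * ∫⁻ z in ball (0 : ℂ) 1, T z := by
  have hT' : Measurable ((ball (0 : ℂ) 1).indicator T) := hT.indicator measurableSet_ball
  have hcov : ∫⁻ z : ℂ, (ball (0 : ℂ) 1).indicator T (r • z) =
      ENNReal.ofReal (r ^ 2)⁻¹ * ∫⁻ z in ball (0 : ℂ) 1, T z := by
    rw [← lintegral_map hT' (measurable_const_smul r), Measure.map_addHaar_smul _ hr0.ne',
      lintegral_smul_measure, Complex.finrank_real_complex, lintegral_indicator measurableSet_ball,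
      abs_of_nonneg (by positivity), smul_eq_mul]
  rw [← hcov, ← lintegral_indicator measurableSet_ball]
  refine lintegral_mono fun z => Set.indicator_le
    (g := fun z => (ball (0 : ℂ) 1).indicator T (r • z)) (fun z hz => ?_) z
  rw [Complex.real_smul, Set.indicator_of_mem (mul_mem_unitBall hr0.le hr hz)]

/-- Dominated convergence on the disc with bounds given by the dilations of one function. -/
theorem tendsto_lintegral_ball_zero_of_le_dilation {T : ℂ → ENNReal} (hT : Measurable T)
    (hTc : ContinuousOn T (ball 0 1)) (hfin : ∫⁻ z in ball (0 : ℂ) 1, T z ≠ ⊤)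
    {r : ℕ → ℝ} (hr0 : ∀ n, 0 < r n) (hr1 : ∀ n, r n ≤ 1) (hr : Tendsto r atTop (𝓝 1))
    {D : ℕ → ℂ → ENNReal} (hD : ∀ n, Measurable (D n)) {C : ENNReal} (hC : C ≠ ⊤)
    (hDT : ∀ n, ∀ z ∈ ball (0 : ℂ) 1, D n z ≤ C * (T (r n * z) + T z))
    (hD0 : ∀ z ∈ ball (0 : ℂ) 1, Tendsto (fun n => D n z) atTop (𝓝 0)) :
    Tendsto (fun n => ∫⁻ z in ball (0 : ℂ) 1, D n z) atTop (𝓝 0) := by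
  have hTr : ∀ n, Measurable fun z : ℂ => T (r n * z) := fun n =>
    hT.comp (measurable_const_mul _)
  have hint : ∀ S : ℂ → ENNReal, ∫⁻ z in ball (0 : ℂ) 1, C * (S z + T z) =
      C * ((∫⁻ z in ball (0 : ℂ) 1, S z) + ∫⁻ z in ball (0 : ℂ) 1, T z) := fun S => by
    rw [lintegral_const_mul' _ _ hC, lintegral_add_right _ hT]
  refine tendsto_lintegral_zero_of_le_of_tendsto (b := fun z => C * (T z + T z))
    (c := fun n => C * (ENNReal.ofReal (r n ^ 2)⁻¹ * (∫⁻ z in ball (0 : ℂ) 1, T z) +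
      ∫⁻ z in ball (0 : ℂ) 1, T z)) hD (fun n => ((hTr n).add hT).const_mul C)
    ((hT.add hT).const_mul C) (fun n => ?_) ?_ ?_ (fun n => ?_) ?_ ?_
  · filter_upwards [ae_restrict_mem measurableSet_ball] with z hz using hDT n z hz
  · rw [hint]
    exact ENNReal.mul_ne_top hC (ENNReal.add_ne_top.2 ⟨hfin, hfin⟩)
  · filter_upwards [ae_restrict_mem measurableSet_ball] with z hz
    have h1 : Tendsto (fun n => (r n : ℂ) * z) atTop (𝓝 z) := by
      have := ((Complex.continuous_ofReal.tendsto 1).comp hr).mul_const z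
      simpa using this
    have h2 := ((hTc.continuousAt (isOpen_ball.mem_nhds hz)).tendsto.comp h1)
    exact ENNReal.Tendsto.const_mul (h2.add tendsto_const_nhds) (Or.inr hC)
  · refine (hint _).trans_le ?_
    gcongr
    exact lintegral_ball_comp_mul_le hT (hr0 n) (hr1 n)
  · rw [hint]
    refine ENNReal.Tendsto.const_mul (Tendsto.add_const _ ?_) (Or.inr hC)
    have h1 : Tendsto (fun n => ENNReal.ofReal (r n ^ 2)⁻¹) atTop (𝓝 1) := by
      have := ENNReal.tendsto_ofReal ((hr.pow 2).inv₀ (by norm_num))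
      simpa using this
    have := ENNReal.Tendsto.mul_const (b := ∫⁻ z in ball (0 : ℂ) 1, T z) h1 (Or.inr hfin)
    simpa using this
  · filter_upwards [ae_restrict_mem measurableSet_ball] with z hz using hD0 z hz

/-! ### Growth of Bloch functions. -/

/-- A Bloch function grows along radii at most logarithmically. -/
theorem norm_sub_comp_mul_le_log {f : ℂ → ℂ} (hf : DifferentiableOn ℂ f (ball 0 1)) {M : ℝ}
    (hM : ∀ z ∈ ball (0 : ℂ) 1, ‖deriv f z‖ * (1 - ‖z‖) ≤ M) {r : ℝ} (hr0 : 0 ≤ r) (hr : r ≤ 1)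
    {z : ℂ} (hz : z ∈ ball (0 : ℂ) 1) :
    ‖f z - f (r * z)‖ ≤ M * Real.log ((1 - r * ‖z‖) / (1 - ‖z‖)) := by
  have hz1 : ‖z‖ < 1 := by simpa using hz
  have hpos : ∀ t ∈ Set.Icc r 1, 0 < 1 - t * ‖z‖ := fun t ht => by
    nlinarith [norm_nonneg z, ht.2]
  have hφ : ∀ t ∈ Set.Icc r 1, HasDerivAt (fun t : ℝ => f (t * z) - f (r * z))
      (deriv f (t * z) * z) t := fun t ht => by
    have h1 := ((hf.differentiableAt (isOpen_ball.mem_nhds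
      (mul_mem_unitBall (hr0.trans ht.1) ht.2 hz))).hasDerivAt)
    have h2 : HasDerivAt (fun t : ℝ => (t : ℂ) * z) z t := by
      simpa using (Complex.ofRealCLM.hasDerivAt (x := t)).mul_const z
    exact (h1.comp t h2).sub_const _
  have hB : ∀ t ∈ Set.Icc r 1, HasDerivAt
      (fun t : ℝ => M * (Real.log (1 - r * ‖z‖) - Real.log (1 - t * ‖z‖)))
      (M * (‖z‖ / (1 - t * ‖z‖))) t := fun t ht => by
    have h1 : HasDerivAt (fun t : ℝ => 1 - t * ‖z‖) (-‖z‖) t := by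
      simpa using ((hasDerivAt_id t).mul_const ‖z‖).const_sub 1
    have h2 := ((h1.log (hpos t ht).ne').const_sub (Real.log (1 - r * ‖z‖))).const_mul M
    convert! h2 using 1
    ring
  -- Both sides vanish at `t = r`, and the derivative of the logarithmic bound dominates that of `f`
  -- along the radius.
  have key := image_norm_le_of_norm_deriv_right_le_deriv_boundary'
    (fun t ht => (hφ t ht).continuousAt.continuousWithinAt)
    (fun t ht => (hφ t ⟨ht.1, ht.2.le⟩).hasDerivWithinAt) (by simp)
    (fun t ht => (hB t ht).continuousAt.continuousWithinAt)
    (fun t ht => (hB t ⟨ht.1, ht.2.le⟩).hasDerivWithinAt) (fun t ht => ?_)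
    (⟨hr, le_rfl⟩ : (1 : ℝ) ∈ Set.Icc r 1)
  · have h1 := hpos 1 ⟨hr, le_rfl⟩
    rw [Real.log_div (hpos r ⟨le_rfl, hr⟩).ne' (by rw [one_mul] at h1; exact h1.ne')]
    simpa using key
  · have ht' : t ∈ Set.Icc r 1 := ⟨ht.1, ht.2.le⟩
    have h1 := hM _ (mul_mem_unitBall (hr0.trans ht.1) ht.2.le hz)
    have h2 : ‖(t : ℂ) * z‖ = t * ‖z‖ := by
      rw [norm_mul, Complex.norm_real, Real.norm_eq_abs, abs_of_nonneg (hr0.trans ht.1)]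
    rw [h2, ← le_div_iff₀ (hpos t ht')] at h1
    rw [norm_mul]
    calc _ ≤ M / (1 - t * ‖z‖) * ‖z‖ := by gcongr
      _ = _ := by ring

theorem Real.add_rpow_le_const_mul_add_rpow {a b p : ℝ} (ha : 0 ≤ a) (hb : 0 ≤ b) (hp : 1 ≤ p) :
    (a + b) ^ p ≤ 2 ^ (p - 1) * (a ^ p + b ^ p) := by
  lift a to NNReal using ha
  lift b to NNReal using hb
  exact_mod_cast NNReal.rpow_add_le_mul_rpow_add_rpow a b hp

/-- The logarithmic growth bound is weakened to a power, which exchanges the weight at `z` for the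
weight at `r * z`, with a constant independent of `r`. -/
theorem exists_weight_mul_norm_sub_rpow_le {f : ℂ → ℂ} (hf : MemBloch f) {p : ℝ} (hp : 1 < p) :
    ∃ K : ℝ, 0 ≤ K ∧ ∀ r : ℝ, 0 ≤ r → r ≤ 1 → ∀ z ∈ ball (0 : ℂ) 1,
      (1 - ‖z‖) ^ (p - 1) * ‖f z - f (r * z)‖ ^ p ≤ K * (1 - r * ‖z‖) ^ (p - 1) := by
  obtain ⟨hd, M, hM⟩ := hf
  replace hM : ∀ z ∈ ball (0 : ℂ) 1, ‖deriv f z‖ * (1 - ‖z‖) ≤ M := fun z hz =>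
    hM (Set.mem_image_of_mem _ hz)
  have hM0 : 0 ≤ M := by
    have := hM 0 (by simp)
    simp only [norm_zero, sub_zero, mul_one] at this
    exact (norm_nonneg _).trans this
  have hp0 : 0 < p := by linarith
  have hp1 : 0 < p - 1 := by linarith
  -- Chosen so that `α * p = p - 1`: the power of `1 - ‖z‖` in the denominator then cancels the
  -- weight exactly.
  set α : ℝ := (p - 1) / p with hα
  have hα0 : 0 < α := by positivity
  refine ⟨(M / α) ^ p, by positivity, fun r hr0 hr z hz => ?_⟩
  have hz1 : 0 < 1 - ‖z‖ := by simpa using hz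
  have hy : 0 < 1 - r * ‖z‖ := by nlinarith [norm_nonneg z]
  have h1 : ‖f z - f (r * z)‖ ≤ M / α * ((1 - r * ‖z‖) / (1 - ‖z‖)) ^ α := by
    refine (norm_sub_comp_mul_le_log hd hM hr0 hr hz).trans ?_
    have := mul_le_mul_of_nonneg_left
      (Real.log_le_rpow_div (x := (1 - r * ‖z‖) / (1 - ‖z‖)) (by positivity) hα0) hM0
    exact this.trans_eq (by ring)
  calc (1 - ‖z‖) ^ (p - 1) * ‖f z - f (r * z)‖ ^ p
      ≤ (1 - ‖z‖) ^ (p - 1) * (M / α * ((1 - r * ‖z‖) / (1 - ‖z‖)) ^ α) ^ p := by gcongr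
    _ = _ := by
      rw [Real.mul_rpow (by positivity) (by positivity), ← Real.rpow_mul (by positivity),
        show α * p = p - 1 by rw [hα]; field_simp, Real.div_rpow hy.le hz1.le]
      have : (1 - ‖z‖) ^ (p - 1) ≠ 0 := by positivity
      field_simp

/-- With `r = 0` in the weight exchange, the integrand is bounded on the disc. -/
theorem lintegral_weight_mul_rpow_lt_top {f : ℂ → ℂ} (hf : MemBloch f) {p : ℝ} (hp : 1 < p) :
    ∫⁻ z in ball (0 : ℂ) 1, ENNReal.ofReal ((1 - ‖z‖) ^ (p - 1) * ‖f z‖ ^ p) < ⊤ := by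
  obtain ⟨K, hK0, hK⟩ := exists_weight_mul_norm_sub_rpow_le hf hp
  have hb : ∀ z ∈ ball (0 : ℂ) 1, ENNReal.ofReal ((1 - ‖z‖) ^ (p - 1) * ‖f z‖ ^ p) ≤
      ENNReal.ofReal (2 ^ (p - 1) * (K + ‖f 0‖ ^ p)) := fun z hz => by
    refine ENNReal.ofReal_le_ofReal ?_
    have hz1 : 0 < 1 - ‖z‖ := by simpa using hz
    have h1 := hK 0 le_rfl zero_le_one z hz
    simp only [Complex.ofReal_zero, zero_mul, sub_zero, Real.one_rpow, mul_one] at h1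
    have h2 : ‖f z‖ ^ p ≤ 2 ^ (p - 1) * (‖f z - f 0‖ ^ p + ‖f 0‖ ^ p) :=
      (Real.rpow_le_rpow (norm_nonneg _) (by simpa using norm_add_le (f z - f 0) (f 0))
        (by linarith)).trans (Real.add_rpow_le_const_mul_add_rpow (norm_nonneg _)
          (norm_nonneg _) hp.le)
    have h3 : (1 - ‖z‖) ^ (p - 1) ≤ 1 :=
      Real.rpow_le_one hz1.le (by linarith [norm_nonneg z]) (by linarith)
    calc _ ≤ (1 - ‖z‖) ^ (p - 1) * (2 ^ (p - 1) * (‖f z - f 0‖ ^ p + ‖f 0‖ ^ p)) := by gcongr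
      _ = 2 ^ (p - 1) * ((1 - ‖z‖) ^ (p - 1) * ‖f z - f 0‖ ^ p +
          (1 - ‖z‖) ^ (p - 1) * ‖f 0‖ ^ p) := by ring
      _ ≤ 2 ^ (p - 1) * (K + 1 * ‖f 0‖ ^ p) := by gcongr
      _ = _ := by rw [one_mul]
  refine (setLIntegral_mono' measurableSet_ball hb).trans_lt ?_
  rw [setLIntegral_const]
  exact ENNReal.mul_lt_top ENNReal.ofReal_lt_top measure_ball_lt_top

/-! ### Basic properties of the energy. -/

theorem measurable_besovEnergy_integrand (p : ℝ) (f : ℂ → ℂ) :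
    Measurable fun z : ℂ => ENNReal.ofReal ((1 - ‖z‖) ^ (p - 1) * ‖deriv f z‖ ^ p) :=
  (((measurable_norm.const_sub 1).pow_const _).mul
    ((measurable_deriv f).norm.pow_const _)).ennreal_ofReal

theorem continuousOn_besovEnergy_integrand {p : ℝ} (hp : 1 ≤ p) {f : ℂ → ℂ}
    (hf : DifferentiableOn ℂ f (ball 0 1)) :
    ContinuousOn (fun z : ℂ => ENNReal.ofReal ((1 - ‖z‖) ^ (p - 1) * ‖deriv f z‖ ^ p))
      (ball 0 1) := by
  refine ENNReal.continuous_ofReal.comp_continuousOn (ContinuousOn.mul ?_ ?_)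
  · exact (Continuous.rpow_const (by fun_prop) fun z => Or.inr (by linarith)).continuousOn
  · exact (hf.deriv isOpen_ball).continuousOn.norm.rpow_const fun z _ => Or.inr (by linarith)

theorem besovEnergy_lt_top_of_norm_le {p : ℝ} (hp : 2 ≤ p) {g : ℂ → ℂ}
    (hg : DifferentiableOn ℂ g (ball 0 1)) {N : ℝ} (hb : ∀ z ∈ ball (0 : ℂ) 1, ‖g z‖ ≤ N) :
    besovEnergy p g < ⊤ := by
  -- The maximum with `1` keeps the normalizing constant positive even if `N = 0`.
  set c : ℝ := max N 1 with hc
  have hc0 : 0 < c := lt_max_of_lt_right one_pos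
  have h1 : besovEnergy p (fun z => (c : ℂ)⁻¹ * g z) < ⊤ := by
    refine (besovEnergy_le_of_norm_le_one hp (hg.const_mul _) fun z hz => ?_).trans_lt
      ENNReal.ofReal_lt_top
    rw [norm_mul, norm_inv, Complex.norm_real, Real.norm_eq_abs, abs_of_pos hc0,
      inv_mul_le_iff₀ hc0, mul_one]
    exact (hb z hz).trans (le_max_left _ _)
  have h2 : besovEnergy p g =
      ENNReal.ofReal (c ^ p) * besovEnergy p (fun z => (c : ℂ)⁻¹ * g z) := by
    unfold besovEnergy
    rw [← lintegral_const_mul' _ _ ENNReal.ofReal_ne_top]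
    refine lintegral_congr fun z => ?_
    rw [← ENNReal.ofReal_mul (by positivity), deriv_const_mul_field, norm_mul, norm_inv,
      Complex.norm_real, Real.norm_eq_abs, abs_of_pos hc0,
      Real.mul_rpow (by positivity) (norm_nonneg _), Real.inv_rpow hc0.le]
    congr 1
    have : c ^ p ≠ 0 := by positivity
    field_simp
  rw [h2]
  exact ENNReal.mul_lt_top ENNReal.ofReal_lt_top h1

theorem besovEnergy_add_le {p : ℝ} (hp : 1 ≤ p) {a b : ℂ → ℂ}
    (ha : DifferentiableOn ℂ a (ball 0 1)) (hb : DifferentiableOn ℂ b (ball 0 1)) :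
    besovEnergy p (fun z => a z + b z) ≤
      ENNReal.ofReal (2 ^ (p - 1)) * (besovEnergy p a + besovEnergy p b) := by
  unfold besovEnergy
  rw [← lintegral_add_left (measurable_besovEnergy_integrand p a),
    ← lintegral_const_mul' _ _ ENNReal.ofReal_ne_top]
  refine setLIntegral_mono' measurableSet_ball fun z hz => ?_
  have hz1 : 0 < 1 - ‖z‖ := by simpa using hz
  rw [← ENNReal.ofReal_add (by positivity) (by positivity), ← ENNReal.ofReal_mul (by positivity)]
  refine ENNReal.ofReal_le_ofReal ?_
  have hn := isOpen_ball.mem_nhds hz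
  have hd : deriv (fun z => a z + b z) z = deriv a z + deriv b z :=
    deriv_add (ha.differentiableAt hn) (hb.differentiableAt hn)
  have h1 : ‖deriv a z + deriv b z‖ ^ p ≤
      2 ^ (p - 1) * (‖deriv a z‖ ^ p + ‖deriv b z‖ ^ p) :=
    (Real.rpow_le_rpow (norm_nonneg _) (norm_add_le _ _) (by linarith)).trans
      (Real.add_rpow_le_const_mul_add_rpow (norm_nonneg _) (norm_nonneg _) hp)
  rw [hd]
  calc _ ≤ (1 - ‖z‖) ^ (p - 1) * (2 ^ (p - 1) * (‖deriv a z‖ ^ p + ‖deriv b z‖ ^ p)) := by gcongr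
    _ = _ := by ring

theorem hasDerivAt_comp_mul {g : ℂ → ℂ} (hg : DifferentiableOn ℂ g (ball 0 1)) {r : ℝ}
    (hr0 : 0 ≤ r) (hr : r ≤ 1) {z : ℂ} (hz : z ∈ ball (0 : ℂ) 1) :
    HasDerivAt (fun z => g (r * z)) (r * deriv g (r * z)) z := by
  have h1 := (hg.differentiableAt (isOpen_ball.mem_nhds (mul_mem_unitBall hr0 hr hz))).hasDerivAt
  have h2 : HasDerivAt (fun z : ℂ => (r : ℂ) * z) r z := by
    simpa using (hasDerivAt_id z).const_mul (r : ℂ)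
  have := h1.comp z h2
  rwa [mul_comm] at this

/-! ### Convergence of the dilated multipliers. -/

/-- If `f` is in the Bloch space and the Besov space, `g` and `g * f` are bounded, then the
dilations of `g` multiply `f` to approximants of `g * f`. -/
theorem tendsto_besovEnergy_dilation_mul_sub {p : ℝ} (hp : 2 ≤ p) {f g : ℂ → ℂ}
    (hf : MemBloch f) (hfE : besovEnergy p f < ⊤) (hg : DifferentiableOn ℂ g (ball 0 1)) {N : ℝ}
    (hgN : ∀ z ∈ ball (0 : ℂ) 1, ‖g z‖ ≤ N) (hgf : ∀ z ∈ ball (0 : ℂ) 1, ‖g z * f z‖ ≤ 1)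
    {r : ℕ → ℝ} (hr0 : ∀ n, 0 < r n) (hr1 : ∀ n, r n ≤ 1) (hr : Tendsto r atTop (𝓝 1)) :
    Tendsto (fun n => besovEnergy p (fun z => g (r n * z) * f z - g z * f z)) atTop (𝓝 0) := by
  have hfd := hf.1
  have hN0 : 0 ≤ N := (norm_nonneg _).trans (hgN 0 (by simp))
  have hp1 : 1 ≤ p := by linarith
  obtain ⟨K, hK0, hK⟩ := exists_weight_mul_norm_sub_rpow_le hf (by linarith : 1 < p)
  set h : ℂ → ℂ := fun z => g z * f z with hh
  have hhd : DifferentiableOn ℂ h (ball 0 1) := hg.mul hfd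
  have hderiv_h : ∀ z ∈ ball (0 : ℂ) 1, deriv h z = deriv g z * f z + g z * deriv f z :=
    fun z hz => deriv_fun_mul (hg.differentiableAt (isOpen_ball.mem_nhds hz))
      (hfd.differentiableAt (isOpen_ball.mem_nhds hz))
  have hderiv : ∀ n, ∀ z ∈ ball (0 : ℂ) 1, deriv (fun z => g (r n * z) * f z - g z * f z) z =
      r n * deriv g (r n * z) * f z + g (r n * z) * deriv f z - deriv h z := fun n z hz => by
    have h1 := (hasDerivAt_comp_mul hg (hr0 n).le (hr1 n) hz).mul
      (hfd.differentiableAt (isOpen_ball.mem_nhds hz)).hasDerivAt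
    exact (h1.sub (hhd.differentiableAt (isOpen_ball.mem_nhds hz)).hasDerivAt).deriv
  set e : (ℂ → ℂ) → ℂ → ℝ := fun u z => (1 - ‖z‖) ^ (p - 1) * ‖deriv u z‖ ^ p with he
  have he0 : ∀ u, ∀ z ∈ ball (0 : ℂ) 1, 0 ≤ e u z := fun u z hz => by
    have hz1 : 0 < 1 - ‖z‖ := by simpa using hz
    positivity
  -- The energy densities of `g`, `g * f` and `f` together; each is integrable, the first two
  -- because `g` and `g * f` are bounded.
  set T : ℂ → ENNReal := fun z =>
    ENNReal.ofReal (e g z) + ENNReal.ofReal (e h z) + ENNReal.ofReal (e f z) with hT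
  have hTeq : ∀ z ∈ ball (0 : ℂ) 1, T z = ENNReal.ofReal (e g z + e h z + e f z) := fun z hz => by
    rw [ENNReal.ofReal_add (add_nonneg (he0 g z hz) (he0 h z hz)) (he0 f z hz),
      ENNReal.ofReal_add (he0 g z hz) (he0 h z hz)]
  have hmeas := measurable_besovEnergy_integrand p
  -- The power `5 ^ (p - 1)` is the convexity constant for a sum of five terms; `K`, `1` and `N ^ p`
  -- are their coefficients.
  set C : ℝ := 5 ^ (p - 1) * (K + 1 + N ^ p) with hC
  refine tendsto_lintegral_ball_zero_of_le_dilation (T := T) (C := ENNReal.ofReal C)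
    (((hmeas g).add (hmeas h)).add (hmeas f))
    (((continuousOn_besovEnergy_integrand hp1 hg).add
      (continuousOn_besovEnergy_integrand hp1 hhd)).add
      (continuousOn_besovEnergy_integrand hp1 hfd)) ?_ hr0 hr1 hr
    (fun n => hmeas _) ENNReal.ofReal_ne_top (fun n z hz => ?_) fun z hz => ?_
  · rw [lintegral_add_right _ (hmeas f), lintegral_add_right _ (hmeas h)]
    exact ENNReal.add_ne_top.2 ⟨ENNReal.add_ne_top.2
      ⟨(besovEnergy_lt_top_of_norm_le hp hg hgN).ne,
        (besovEnergy_lt_top_of_norm_le hp hhd hgf).ne⟩, hfE.ne⟩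
  · have hrz := mul_mem_unitBall (hr0 n).le (hr1 n) hz
    have hz1 : 0 < 1 - ‖z‖ := by simpa using hz
    have hrz1 : 0 < 1 - ‖(r n : ℂ) * z‖ := by simpa using hrz
    have hnorm : ‖(r n : ℂ) * z‖ = r n * ‖z‖ := by
      rw [norm_mul, Complex.norm_real, Real.norm_eq_abs, abs_of_pos (hr0 n)]
    have hw : 1 - ‖z‖ ≤ 1 - ‖(r n : ℂ) * z‖ := by
      rw [hnorm]; nlinarith [norm_nonneg z, hr1 n]
    have hwp : (1 - ‖z‖) ^ (p - 1) ≤ (1 - ‖(r n : ℂ) * z‖) ^ (p - 1) :=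
      Real.rpow_le_rpow hz1.le hw (by linarith)
    rw [hTeq _ hrz, hTeq _ hz,
      ← ENNReal.ofReal_add (add_nonneg (add_nonneg (he0 _ _ hrz) (he0 _ _ hrz)) (he0 _ _ hrz))
        (add_nonneg (add_nonneg (he0 _ _ hz) (he0 _ _ hz)) (he0 _ _ hz)),
      ← ENNReal.ofReal_mul (by positivity)]
    refine ENNReal.ofReal_le_ofReal ?_
    rw [hderiv n z hz]
    set w : ℂ := (r n : ℂ) * z with hwdef
    have hrn : ‖(r n : ℂ)‖ ≤ 1 := by
      rw [Complex.norm_real, Real.norm_eq_abs, abs_of_pos (hr0 n)]; exact hr1 n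
    have hX : ‖(r n : ℂ) * deriv g w * f z + g w * deriv f z - deriv h z‖ ≤
        ‖deriv g w‖ * ‖f z - f w‖ + ‖deriv h w‖ + N * ‖deriv f w‖ + N * ‖deriv f z‖ +
          ‖deriv h z‖ := by
      -- The product rule at `w` gives `g'(w) f(w) = h'(w) - g(w) f'(w)`, so that `f` itself enters
      -- only through the difference `f z - f w`.
      have hsplit : (r n : ℂ) * deriv g w * f z + g w * deriv f z - deriv h z =
          r n * (deriv g w * (f z - f w)) + r n * deriv h w + -(r n * (g w * deriv f w)) +
            g w * deriv f z + -deriv h z := by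
        rw [hderiv_h w hrz]; ring
      have hb : ∀ x : ℂ, ‖(r n : ℂ) * x‖ ≤ ‖x‖ := fun x => by
        rw [norm_mul]; exact mul_le_of_le_one_left (norm_nonneg _) hrn
      rw [hsplit]
      refine (norm_add_le _ _).trans (add_le_add ((norm_add_le _ _).trans (add_le_add
        ((norm_add_le _ _).trans (add_le_add ((norm_add_le _ _).trans
          (add_le_add ?_ (hb _))) ?_)) ?_)) (norm_neg _).le)
      · exact (hb _).trans (norm_mul _ _).le
      · rw [norm_neg]
        refine (hb _).trans ((norm_mul _ _).trans_le ?_)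
        gcongr
        exact hgN w hrz
      · rw [norm_mul]
        gcongr
        exact hgN w hrz
    set X : Fin 5 → ℝ := ![‖deriv g w‖ * ‖f z - f w‖, ‖deriv h w‖, N * ‖deriv f w‖,
      N * ‖deriv f z‖, ‖deriv h z‖] with hXdef
    have hX0 : ∀ i ∈ Finset.univ, 0 ≤ X i := fun i _ => by
      fin_cases i <;> simp [hXdef] <;> positivity
    have hpow := Real.rpow_sum_le_const_mul_sum_rpow_of_nonneg Finset.univ hp1 hX0
    simp only [Finset.card_univ, Fintype.card_fin, Fin.sum_univ_five, hXdef, Matrix.cons_val]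
      at hpow
    have hNN : ∀ x : ℝ, 0 ≤ x → (N * x) ^ p = N ^ p * x ^ p := fun x hx => Real.mul_rpow hN0 hx
    rw [hNN _ (norm_nonneg _), hNN _ (norm_nonneg _),
      Real.mul_rpow (norm_nonneg _) (norm_nonneg _)] at hpow
    have hKz := hK (r n) (hr0 n).le (hr1 n) z hz
    rw [← hwdef, ← hnorm] at hKz
    have t1 : (1 - ‖z‖) ^ (p - 1) * (‖deriv g w‖ ^ p * ‖f z - f w‖ ^ p) ≤ K * e g w := by
      calc _ = ‖deriv g w‖ ^ p * ((1 - ‖z‖) ^ (p - 1) * ‖f z - f w‖ ^ p) := by ring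
        _ ≤ ‖deriv g w‖ ^ p * (K * (1 - ‖w‖) ^ (p - 1)) := by gcongr
        _ = _ := by simp only [he]; ring
    have t2 : (1 - ‖z‖) ^ (p - 1) * ‖deriv h w‖ ^ p ≤ e h w := by
      simp only [he]; gcongr
    have t3 : (1 - ‖z‖) ^ (p - 1) * ‖deriv f w‖ ^ p ≤ e f w := by
      simp only [he]; gcongr
    have hNp : 0 ≤ N ^ p := by positivity
    calc _ ≤ (1 - ‖z‖) ^ (p - 1) * (5 ^ (p - 1) * (‖deriv g w‖ ^ p * ‖f z - f w‖ ^ p +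
          ‖deriv h w‖ ^ p + N ^ p * ‖deriv f w‖ ^ p + N ^ p * ‖deriv f z‖ ^ p +
          ‖deriv h z‖ ^ p)) := by
          refine mul_le_mul_of_nonneg_left ?_ (by positivity)
          refine (Real.rpow_le_rpow (norm_nonneg _) hX (by linarith)).trans ?_
          exact_mod_cast hpow
      _ = 5 ^ (p - 1) * ((1 - ‖z‖) ^ (p - 1) * (‖deriv g w‖ ^ p * ‖f z - f w‖ ^ p) +
          (1 - ‖z‖) ^ (p - 1) * ‖deriv h w‖ ^ p +
          N ^ p * ((1 - ‖z‖) ^ (p - 1) * ‖deriv f w‖ ^ p) + N ^ p * e f z + e h z) := by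
          simp only [he]; ring
      _ ≤ 5 ^ (p - 1) * (K * e g w + e h w + N ^ p * e f w + N ^ p * e f z + e h z) := by gcongr
      _ ≤ 5 ^ (p - 1) *
          ((K + 1 + N ^ p) * (e g w + e h w + e f w + (e g z + e h z + e f z))) := by
          refine mul_le_mul_of_nonneg_left ?_ (by positivity)
          have a1 := he0 g w hrz
          have a2 := he0 h w hrz
          have a3 := he0 f w hrz
          have a4 := he0 g z hz
          have a5 := he0 h z hz
          have a6 := he0 f z hz
          have b1 : 0 ≤ (1 + N ^ p) * e g w := by positivity
          have b2 : 0 ≤ (K + N ^ p) * e h w := by positivity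
          have b3 : 0 ≤ (K + 1) * e f w := by positivity
          have b4 : 0 ≤ (K + 1 + N ^ p) * e g z := by positivity
          have b5 : 0 ≤ (K + N ^ p) * e h z := by positivity
          have b6 : 0 ≤ (K + 1) * e f z := by positivity
          linarith
      _ = _ := by rw [hC]; ring
  · have hn := isOpen_ball.mem_nhds hz
    have h1 : Tendsto (fun n => (r n : ℂ)) atTop (𝓝 1) := by
      simpa [Function.comp_def] using (Complex.continuous_ofReal.tendsto 1).comp hr
    have h2 : Tendsto (fun n => (r n : ℂ) * z) atTop (𝓝 z) := by
      simpa using h1.mul_const z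
    have h3 := ((hg.deriv isOpen_ball).continuousOn.continuousAt hn).tendsto.comp h2
    have h4 := (hg.continuousOn.continuousAt hn).tendsto.comp h2
    have h5 := ((((h1.mul h3).mul_const (f z)).add (h4.mul_const (deriv f z))).sub_const
      (deriv h z)).norm.rpow_const (p := p) (Or.inr (by linarith))
    have h6 := ENNReal.tendsto_ofReal (h5.const_mul ((1 - ‖z‖) ^ (p - 1)))
    rw [one_mul, ← hderiv_h z hz, sub_self, norm_zero, Real.zero_rpow (by linarith), mul_zero,
      ENNReal.ofReal_zero] at h6
    refine h6.congr fun n => ?_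
    rw [hderiv n z hz]
    rfl

/-! ### Polynomial approximation. -/

/-- Functions analytic across the closed unit disc are uniform limits there, with their
derivatives, of polynomials with the same value at the origin. -/
theorem exists_polynomial_approx_deriv {G : ℂ → ℂ} {R : ℝ} (hR : 1 < R)
    (hG : DifferentiableOn ℂ G (ball 0 R)) {δ : ℝ} (hδ : 0 < δ) :
    ∃ P : Polynomial ℂ, P.eval 0 = G 0 ∧
      ∀ z ∈ ball (0 : ℂ) 1, ‖P.eval z - G z‖ ≤ δ ∧ ‖P.derivative.eval z - deriv G z‖ ≤ δ := by
  obtain ⟨ρ, hρ1, hρR⟩ := exists_between hR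
  lift ρ to NNReal using (zero_le_one.trans hρ1.le)
  have hps := (hG.mono (closedBall_subset_ball hρR)).hasFPowerSeriesOnBall
    (by exact_mod_cast zero_lt_one.trans hρ1)
  set q := cauchyPowerSeries G 0 ρ
  set P : ℕ → Polynomial ℂ := fun n => ∑ i ∈ Finset.range n, Polynomial.monomial i (q.coeff i)
  have hP : ∀ n z, (P n).eval z = q.partialSum n z := fun n z => by
    simp only [P, Polynomial.eval_finsetSum, Polynomial.eval_monomial,
      FormalMultilinearSeries.partialSum, FormalMultilinearSeries.apply_eq_pow_smul_coeff,
      smul_eq_mul]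
    exact Finset.sum_congr rfl fun i _ => mul_comm _ _
  have hloc : TendstoLocallyUniformlyOn (fun n z => (P n).eval z) G atTop (ball 0 ρ) := by
    have := hps.tendstoLocallyUniformlyOn
    simp only [zero_add, Metric.eball_coe] at this
    exact this.congr fun n z _ => (hP n z).symm
  have hloc' := hloc.deriv (Eventually.of_forall fun n => (P n).differentiable.differentiableOn)
    isOpen_ball
  have hsub : closedBall (0 : ℂ) 1 ⊆ ball 0 ρ := closedBall_subset_ball hρ1
  have hcpt := isCompact_closedBall (0 : ℂ) 1
  have hu := (tendstoLocallyUniformlyOn_iff_tendstoUniformlyOn_of_compact hcpt).1 (hloc.mono hsub)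
  have hu' := (tendstoLocallyUniformlyOn_iff_tendstoUniformlyOn_of_compact hcpt).1
    (hloc'.mono hsub)
  rw [Metric.tendstoUniformlyOn_iff] at hu hu'
  -- With `n ≥ 1` the partial sum contains the constant term, so its value at the origin is exact.
  obtain ⟨n, hn, hn', hn1⟩ :=
    ((hu δ hδ).and ((hu' δ hδ).and (eventually_ge_atTop 1))).exists
  refine ⟨P n, ?_, fun z hz => ⟨?_, ?_⟩⟩
  · rw [hP, ← hps.coeff_zero 0]
    obtain ⟨m, rfl⟩ : ∃ m, n = m + 1 := ⟨n - 1, by omega⟩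
    simp only [FormalMultilinearSeries.partialSum,
      FormalMultilinearSeries.apply_eq_pow_smul_coeff]
    rw [Finset.sum_range_succ']
    simp
  · have := hn z (ball_subset_closedBall hz)
    rw [dist_comm, dist_eq_norm] at this
    exact this.le
  · have := hn' z (ball_subset_closedBall hz)
    rw [dist_comm, dist_eq_norm, Function.comp_apply, Polynomial.deriv] at this
    exact this.le

theorem besovEnergy_mul_le {p : ℝ} (hp : 1 ≤ p) {f u : ℂ → ℂ}
    (hf : DifferentiableOn ℂ f (ball 0 1)) (hu : DifferentiableOn ℂ u (ball 0 1)) {δ : ℝ}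
    (hδ : 0 ≤ δ) (h0 : ∀ z ∈ ball (0 : ℂ) 1, ‖u z‖ ≤ δ)
    (h1 : ∀ z ∈ ball (0 : ℂ) 1, ‖deriv u z‖ ≤ δ) :
    besovEnergy p (fun z => u z * f z) ≤ ENNReal.ofReal (2 ^ (p - 1) * δ ^ p) *
      ((∫⁻ z in ball (0 : ℂ) 1, ENNReal.ofReal ((1 - ‖z‖) ^ (p - 1) * ‖f z‖ ^ p)) +
        besovEnergy p f) := by
  unfold besovEnergy
  rw [← lintegral_add_right _ (measurable_besovEnergy_integrand p f),
    ← lintegral_const_mul' _ _ ENNReal.ofReal_ne_top]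
  refine setLIntegral_mono' measurableSet_ball fun z hz => ?_
  have hz1 : 0 < 1 - ‖z‖ := by simpa using hz
  rw [← ENNReal.ofReal_add (by positivity) (by positivity), ← ENNReal.ofReal_mul (by positivity)]
  refine ENNReal.ofReal_le_ofReal ?_
  have hn := isOpen_ball.mem_nhds hz
  have hd : deriv (fun z => u z * f z) z = deriv u z * f z + u z * deriv f z :=
    deriv_fun_mul (hu.differentiableAt hn) (hf.differentiableAt hn)
  have h2 : ‖deriv u z * f z + u z * deriv f z‖ ≤ δ * ‖f z‖ + δ * ‖deriv f z‖ := by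
    refine (norm_add_le _ _).trans ?_
    rw [norm_mul, norm_mul]
    gcongr
    · exact h1 z hz
    · exact h0 z hz
  have h3 := (Real.rpow_le_rpow (norm_nonneg _) h2 (by linarith : 0 ≤ p)).trans
    (Real.add_rpow_le_const_mul_add_rpow (by positivity) (by positivity) hp)
  rw [Real.mul_rpow hδ (norm_nonneg _), Real.mul_rpow hδ (norm_nonneg _)] at h3
  rw [hd]
  calc _ ≤ (1 - ‖z‖) ^ (p - 1) *
        (2 ^ (p - 1) * (δ ^ p * ‖f z‖ ^ p + δ ^ p * ‖deriv f z‖ ^ p)) := by gcongr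
    _ = _ := by ring

/-- The dilation is analytic on the disc of radius `r⁻¹ > 1`. Multiplying `f` by an error that is
small together with its derivative costs little energy, since the weighted `p`-th power integrals of
`f` and of its derivative are finite. -/
theorem exists_polynomial_besovEnergy_mul_sub_lt {p : ℝ} (hp : 2 ≤ p) {f g : ℂ → ℂ}
    (hf : MemBloch f) (hfE : besovEnergy p f < ⊤) (hg : DifferentiableOn ℂ g (ball 0 1)) {r : ℝ}
    (hr0 : 0 < r) (hr : r < 1) {η : ENNReal} (hη : 0 < η) :
    ∃ P : Polynomial ℂ, P.eval 0 = g 0 ∧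
      besovEnergy p (fun z => P.eval z * f z - g (r * z) * f z) < η := by
  set A := (∫⁻ z in ball (0 : ℂ) 1, ENNReal.ofReal ((1 - ‖z‖) ^ (p - 1) * ‖f z‖ ^ p)) +
    besovEnergy p f with hA
  have hAfin : A ≠ ⊤ :=
    (ENNReal.add_lt_top.2 ⟨lintegral_weight_mul_rpow_lt_top hf (by linarith), hfE⟩).ne
  have ht : Tendsto (fun δ : ℝ => ENNReal.ofReal (2 ^ (p - 1) * δ ^ p) * A) (𝓝[>] 0) (𝓝 0) := by
    have h1 : Tendsto (fun δ : ℝ => 2 ^ (p - 1) * δ ^ p) (𝓝[>] 0) (𝓝 0) := by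
      have := ((Real.continuous_rpow_const (by linarith : 0 ≤ p)).tendsto 0).const_mul
        ((2 : ℝ) ^ (p - 1))
      rw [Real.zero_rpow (by linarith), mul_zero] at this
      exact tendsto_nhdsWithin_of_tendsto_nhds this
    have := ENNReal.Tendsto.mul_const (ENNReal.tendsto_ofReal h1) (Or.inr hAfin)
    simpa using this
  obtain ⟨δ, hδη, hδ⟩ := ((ht.eventually (gt_mem_nhds hη)).and self_mem_nhdsWithin).exists
  have hG : DifferentiableOn ℂ (fun z => g (r * z)) (ball 0 r⁻¹) := by
    refine hg.comp (by fun_prop) fun z hz => ?_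
    have hz' : ‖z‖ < r⁻¹ := by simpa using hz
    simp only [mem_ball, dist_zero_right, norm_mul, Complex.norm_real, Real.norm_eq_abs,
      abs_of_pos hr0]
    calc r * ‖z‖ < r * r⁻¹ := by gcongr
      _ = 1 := mul_inv_cancel₀ hr0.ne'
  have hR : 1 < r⁻¹ := (one_lt_inv₀ hr0).2 hr
  obtain ⟨P, hP0, hP⟩ := exists_polynomial_approx_deriv hR hG hδ
  refine ⟨P, by simpa using hP0, lt_of_le_of_lt ?_ hδη⟩
  have hG1 := hG.mono (ball_subset_ball hR.le)
  have hPd := P.differentiable.differentiableOn (s := ball (0 : ℂ) 1)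
  have := besovEnergy_mul_le (p := p) (by linarith) hf.1 (hPd.sub hG1) (le_of_lt hδ)
    (fun z hz => (hP z hz).1) (fun z hz => by
      have hn := isOpen_ball.mem_nhds hz
      rw [deriv_sub (hPd.differentiableAt hn) (hG1.differentiableAt hn), Polynomial.deriv]
      exact (hP z hz).2)
  simpa only [Pi.sub_apply, sub_mul] using this

/-! ### Assembly of the approximation. -/

/-- The error splits as `P f - 1 = (P f - g_r f) + (g_r f - g f) + (g f - 1)`, and each summand has
small energy. -/
theorem IsOuter.exists_polynomial_besovNorm_lt {p : ℝ} (hp : 2 < p) {f : ℂ → ℂ} (hf : IsOuter f)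
    (hfE : besovEnergy p f < ⊤) (hfB : MemBloch f) {η : ENNReal} (hη : 0 < η) :
    ∃ P : Polynomial ℂ, besovNorm p (fun z => P.eval z * f z - 1) < η := by
  have hp0 : 0 < p := by linarith
  set c := ENNReal.ofReal (2 ^ (p - 1)) with hc
  have hcfin : c ≠ ⊤ := ENNReal.ofReal_ne_top
  -- The nested factors `c` come from adding three energies two at a time; `π ε` is `π/2` times the
  -- bound `2 ε` for `1 - ‖g 0 * f 0‖ ^ 2`.
  set bound : ℝ → ENNReal := fun ε => ENNReal.ofReal ε +
    (c * (ENNReal.ofReal ε + c * (ENNReal.ofReal ε + ENNReal.ofReal (Real.pi * ε)))) ^ (1 / p)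
  have ht : Tendsto bound (𝓝[>] 0) (𝓝 0) := by
    have h1 : Tendsto (fun ε : ℝ => ENNReal.ofReal ε) (𝓝[>] 0) (𝓝 0) := by
      simpa using tendsto_nhdsWithin_of_tendsto_nhds (ENNReal.continuous_ofReal.tendsto 0)
    have h2 : Tendsto (fun ε : ℝ => ENNReal.ofReal (Real.pi * ε)) (𝓝[>] 0) (𝓝 0) := by
      have : Continuous fun ε : ℝ => ENNReal.ofReal (Real.pi * ε) :=
        ENNReal.continuous_ofReal.comp (by fun_prop)
      simpa using tendsto_nhdsWithin_of_tendsto_nhds (this.tendsto 0)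
    have h3 := ENNReal.Tendsto.const_mul (a := c) (h1.add
      (ENNReal.Tendsto.const_mul (a := c) (h1.add h2) (Or.inr hcfin))) (Or.inr hcfin)
    have h4 := h1.add (((ENNReal.continuous_rpow_const (y := 1 / p)).tendsto _).comp h3)
    have h5 : (0 : ENNReal) ^ (1 / p) = 0 := ENNReal.zero_rpow_of_pos (by positivity)
    simp only [add_zero, mul_zero, h5] at h4
    exact h4
  obtain ⟨ε, hεη, hε : 0 < ε⟩ := ((ht.eventually (gt_mem_nhds hη)).and self_mem_nhdsWithin).exists
  refine Exists.imp (fun P hP => lt_of_le_of_lt hP hεη) ?_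
  have hε' : 0 < ENNReal.ofReal ε := ENNReal.ofReal_pos.2 hε
  obtain ⟨g, N, hg, hgN, hgf, hg0⟩ := hf.exists_bounded_multiplier hε
  set r : ℕ → ℝ := fun n => 1 - 1 / ((n : ℝ) + 2) with hr
  have hpos : ∀ n : ℕ, 0 < 1 / ((n : ℝ) + 2) := fun n => by positivity
  have hr1 : ∀ n, r n < 1 := fun n => by simp only [hr]; linarith [hpos n]
  have hr0 : ∀ n, 0 < r n := fun n => by
    have : 1 / ((n : ℝ) + 2) < 1 := by
      rw [div_lt_one (by positivity)]; linarith [n.cast_nonneg (α := ℝ)]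
    simp only [hr]; linarith
  have hrt : Tendsto r atTop (𝓝 1) := by
    have h1 : Tendsto (fun n : ℕ => 1 / ((n : ℝ) + 2)) atTop (𝓝 0) :=
      (tendsto_const_nhds (x := (1 : ℝ))).div_atTop
        (tendsto_atTop_add_const_right _ 2 tendsto_natCast_atTop_atTop)
    simpa [hr] using h1.const_sub 1
  obtain ⟨n, hn⟩ := ((tendsto_besovEnergy_dilation_mul_sub hp.le hfB hfE hg hgN hgf hr0
    (fun n => (hr1 n).le) hrt).eventually (gt_mem_nhds hε')).exists
  obtain ⟨P, hP0, hP⟩ :=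
    exists_polynomial_besovEnergy_mul_sub_lt hp.le hfB hfE hg (hr0 n) (hr1 n) hε'
  refine ⟨P, ?_⟩
  have hgr : DifferentiableOn ℂ (fun z => g (r n * z)) (ball 0 1) := fun z hz =>
    (hasDerivAt_comp_mul hg (hr0 n).le (hr1 n).le hz).differentiableAt.differentiableWithinAt
  have d1 : DifferentiableOn ℂ (fun z => P.eval z * f z - g (r n * z) * f z) (ball 0 1) :=
    (P.differentiable.differentiableOn.mul hfB.1).sub (hgr.mul hfB.1)
  have d2 : DifferentiableOn ℂ (fun z => g (r n * z) * f z - g z * f z) (ball 0 1) :=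
    (hgr.mul hfB.1).sub (hg.mul hfB.1)
  have d3 : DifferentiableOn ℂ (fun z => g z * f z - 1) (ball 0 1) :=
    (hg.mul hfB.1).sub_const 1
  have e3 : besovEnergy p (fun z => g z * f z - 1) ≤ ENNReal.ofReal (Real.pi * ε) := by
    have h1 : besovEnergy p (fun z => g z * f z - 1) = besovEnergy p (fun z => g z * f z) := by
      unfold besovEnergy
      simp only [deriv_sub_const_fun]
    rw [h1]
    refine (besovEnergy_le_of_norm_le_one hp.le (hg.mul hfB.1) hgf).trans
      (ENNReal.ofReal_le_ofReal ?_)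
    have h2 := hgf 0 (by simp)
    have h3 : 1 - ‖g 0 * f 0‖ < ε := by
      refine lt_of_le_of_lt ?_ hg0
      rw [norm_sub_rev]
      simpa using norm_sub_norm_le (1 : ℂ) (g 0 * f 0)
    have h4 : 1 - ‖g 0 * f 0‖ ^ 2 ≤ 2 * ε := by nlinarith [norm_nonneg (g 0 * f 0)]
    calc Real.pi / 2 * (1 - ‖g 0 * f 0‖ ^ 2) ≤ Real.pi / 2 * (2 * ε) :=
          mul_le_mul_of_nonneg_left h4 (by positivity)
      _ = Real.pi * ε := by ring
  have e2 := (besovEnergy_add_le (by linarith : 1 ≤ p) d2 d3).trans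
    (mul_le_mul_right (add_le_add hn.le e3) _)
  have e1 := (besovEnergy_add_le (by linarith : 1 ≤ p) d1 (d2.add d3)).trans
    (mul_le_mul_right (add_le_add hP.le e2) _)
  have hsum : (fun z => P.eval z * f z - g (r n * z) * f z +
      ((fun z => g (r n * z) * f z - g z * f z) + fun z => g z * f z - 1) z) =
      fun z => P.eval z * f z - 1 := by
    ext z; simp only [Pi.add_apply]; ring
  rw [hsum] at e1
  refine add_le_add (ENNReal.ofReal_le_ofReal ?_) (ENNReal.rpow_le_rpow e1 (by positivity))
  dsimp only
  rw [hP0]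
  exact hg0.le

theorem mainTheorem6 (p : ℝ) (hp : 2 < p) (f : ℂ → ℂ) (hf : IsOuter f)
    (hfB : MemBesov p f) (hfBloch : MemBloch f) :
    IsCyclicBesov p f := by
  refine ⟨hfB, ?_⟩
  have hfE : besovEnergy p f < ⊤ := by
    by_contra h
    have htop : besovEnergy p f = ⊤ := not_lt_top_iff.1 h
    refine hfB.2.ne ?_
    change ENNReal.ofReal ‖f 0‖ + besovEnergy p f ^ (1 / p) = ⊤
    rw [htop, ENNReal.top_rpow_of_pos (by positivity), add_top]
  -- At `n = 0` the inverse is `⊤`, so the tolerance is still positive.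
  have hpos : ∀ n : ℕ, (0 : ENNReal) < (n : ENNReal)⁻¹ := fun n =>
    ENNReal.inv_pos.2 (ENNReal.natCast_ne_top n)
  choose P hP using fun n => hf.exists_polynomial_besovNorm_lt hp hfE hfBloch (hpos n)
  exact ⟨P, tendsto_of_tendsto_of_tendsto_of_le_of_le tendsto_const_nhds
    ENNReal.tendsto_inv_nat_nhds_zero (fun n => zero_le) fun n => (hP n).le⟩
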